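/- Let $H$ be a separable complex Hilbert space and $L(H)$ the algebra of bounded linear operators on $H$. Let $A_W$ be the Wiener algebra of functions $f(t)=\sum_{n\ge0}f_nt^n$ on the closed unit disc $\overline{\mathbb D}$ with $\sum_n|f_n|<\infty$. For $T\in L(H)$ let $\mathcal A_{T,\mathbb R}$ (respectively $\mathcal A^0_{T,\mathbb R}$) be the set of all $f\in A_W$ with real Taylor coefficients $f_n$ for which $\sum_{n\ge0}|f_n|T^{*n}T^n$ converges in the strong operator topology (respectively in the operator norm). For a function $f$ that is analytic in the open unit disc $\mathbb D$, with Taylor coefficients $f_n$, write $f(T^*,T)=\sum_{n\ge0}f_nT^{*n}T^n$ whenever this series converges in the strong operator topology; $f(T^*,T)\ge0$ means that the series converges in this topology and that its sum is a positive semidefinite operator. Let $\hat T\in L(H)$ have spectrum $\sigma(\hat T)\subset\overline{\mathbb D}$, and let $\gamma(t)=\alpha(t)\tilde\gamma(t)$ for $t\in\mathbb D$, where $\alpha\in\mathcal A_{\hat T,\mathbb R}$, and $\tilde\gamma\in\mathcal A^0_{\hat T,\mathbb R}$ satisfies $\tilde\gamma(t)>0$ for every $t\in[0,1]$. If $\gamma(\hat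 T^*,\hat T)\ge0$, then $\hat T$ is similar to an operator $T\in L(H)$ (that is, $T=V\hat TV^{-1}$ for some bounded invertible operator $V$ on $H$) such that $\alpha(T^*,T)\ge0$. -/

import Mathlib

open Filter Topology

noncomputable section

/-- The `n`-th Taylor coefficient of `f` at the origin. -/
def taylorCoeff (f : ℂ → ℂ) (n : ℕ) : ℂ :=
  iteratedDeriv n f 0 / (n.factorial : ℂ)

/-- The Wiener algebra `A_W`: the functions whose Taylor coefficients at the origin are absolutely
summable and which are the sum of their Taylor series. Such a function extends continuously to the
closed unit disc, so it is regarded as a function there; its values outside the closed unit disc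
play no role. -/
def WienerAlgebra : Set (ℂ → ℂ) :=
  {f | Summable (fun n => ‖taylorCoeff f n‖) ∧
    ∀ z ∈ Metric.closedBall (0 : ℂ) 1, HasSum (fun n => taylorCoeff f n * z ^ n) (f z)}

section Operators

variable {H : Type*} [NormedAddCommGroup H] [InnerProductSpace ℂ H] [CompleteSpace H]

/-- The partial sum `∑_{n < N} c_n T^{*n} T^n`. -/
def hereditaryPartialSum (c : ℕ → ℂ) (T : H →L[ℂ] H) (N : ℕ) : H →L[ℂ] H :=
  ∑ n ∈ Finset.range N, c n • ((ContinuousLinearMap.adjoint T) ^ n * T ^ n)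

/-- The series `∑ c_n T^{*n} T^n` converges to the bounded operator `A` in the strong operator
topology. -/
def HasHereditarySumSOT (c : ℕ → ℂ) (T A : H →L[ℂ] H) : Prop :=
  ∀ x : H, Tendsto (fun N => hereditaryPartialSum c T N x) atTop (𝓝 (A x))

/-- The series `∑ c_n T^{*n} T^n` converges to `A` in the operator norm. -/
def HasHereditarySumNorm (c : ℕ → ℂ) (T A : H →L[ℂ] H) : Prop :=
  Tendsto (hereditaryPartialSum c T) atTop (𝓝 A)

/-- `𝒜_T`: the functions `f` in the Wiener algebra for which `∑ |f_n| T^{*n} T^n` converges in the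
strong operator topology. -/
def algA (T : H →L[ℂ] H) : Set (ℂ → ℂ) :=
  {f | f ∈ WienerAlgebra ∧
    ∃ A : H →L[ℂ] H, HasHereditarySumSOT (fun n => (‖taylorCoeff f n‖ : ℂ)) T A}

/-- `𝒜_T^0`: the functions `f` in the Wiener algebra for which `∑ |f_n| T^{*n} T^n` converges in
the operator norm. -/
def algAZero (T : H →L[ℂ] H) : Set (ℂ → ℂ) :=
  {f | f ∈ WienerAlgebra ∧
    ∃ A : H →L[ℂ] H, HasHereditarySumNorm (fun n => (‖taylorCoeff f n‖ : ℂ)) T A}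

/-- `𝒜_{T,ℝ}`: the functions in `𝒜_T` with real Taylor coefficients. -/
def algAReal (T : H →L[ℂ] H) : Set (ℂ → ℂ) :=
  {f | f ∈ algA T ∧ ∀ n, (taylorCoeff f n).im = 0}

/-- `𝒜_{T,ℝ}^0`: the functions in `𝒜_T^0` with real Taylor coefficients. -/
def algAZeroReal (T : H →L[ℂ] H) : Set (ℂ → ℂ) :=
  {f | f ∈ algAZero T ∧ ∀ n, (taylorCoeff f n).im = 0}

/-- `f(T^*,T) ≥ 0`: the series `∑ f_n T^{*n} T^n` converges in the strong operator topology, and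
its sum is a positive (semidefinite) operator. -/
def HereditaryNonneg (f : ℂ → ℂ) (T : H →L[ℂ] H) : Prop :=
  ∃ A : H →L[ℂ] H, HasHereditarySumSOT (taylorCoeff f) T A ∧ A.IsPositive

/-- `S` and `T` are similar: `T = V S V⁻¹` for some bounded invertible operator `V`. -/
def SimilarOperators (S T : H →L[ℂ] H) : Prop :=
  ∃ V : H ≃L[ℂ] H, T = (V : H →L[ℂ] H) ∘L S ∘L (V.symm : H →L[ℂ] H)

end Operators

end

/-!
For a fixed `T`, a power series `a` defines the quadratic form `x ↦ ∑ aₙ ‖Tⁿ x‖²` of `a(T*, T)`.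
The form of a product `a b` at `x` is `∑ aₙ` times the form of `b` at `Tⁿ x`. Hence, if `V` is
invertible and `‖V x‖²` is the form of a real series `c`, then the form of `α` for `V T V⁻¹` at
`V x` is the form of `α c` for `T` at `x`.

So it suffices to find `h` with nonnegative coefficients such that the form of `c = h γ̃` is
coercive: this form is then `‖V x‖²` for some invertible `V`, and the form of `α c = h γ` is
nonnegative together with that of `γ`. Operator norm convergence and `γ̃ > 0` on `[0, 1]` give a
polynomial `p`, a Taylor polynomial of `γ̃` minus a small constant, that is positive on `[0, 1]`
while the form of `γ̃ - p` is coercive. As in Pólya's theorem, the `k`-th coefficient of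
`q(t) (1 - t)^{-(n+1)}` is `(q(k/(n+k)) + O(1/n)) * choose (n+k) n` uniformly in `k`; applied to
`q(t) = p(ρ t)` with `ρ > 1`, this gives `h(t) = (1 - t/ρ)^{-(n+1)}` such that `h p` has nonnegative
coefficients, and the form of `h γ̃ = h p + h (γ̃ - p)` dominates that of `γ̃ - p`.
-/

section Polya

open PowerSeries
open scoped Polynomial

theorem cast_choose_eq_div_mul_choose_succ {K : Type*} [Field K] [CharZero K] (n m : ℕ) :
    ((n + m).choose n : K) = (m + 1) / (n + m + 1) * (n + (m + 1)).choose n := by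
  have h := Nat.choose_mul_succ_eq (n + m) n
  rw [show n + m + 1 - n = m + 1 by lia, add_assoc] at h
  have h' : ((n + m).choose n : K) * (n + (m + 1)) = (n + (m + 1)).choose n * (m + 1) := by
    exact_mod_cast h
  have hne : (n + m + 1 : K) ≠ 0 := by exact_mod_cast (n + m).succ_ne_zero
  field_simp
  linear_combination h'

variable {K : Type*} [Field K] [LinearOrder K] [IsStrictOrderedRing K]

theorem abs_add_one_div_sub_add_div_le {n m j : K} (hn : 0 < n) (hm : 0 ≤ m) (hj : 0 ≤ j) :
    |(m + 1) / (n + m + 1) - (m + (j + 1)) / (n + (m + (j + 1)))| ≤ j / n := by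
  have h : (m + (j + 1)) / (n + (m + (j + 1))) - (m + 1) / (n + m + 1) =
      j / (n + m + 1) * (n / (n + (m + (j + 1)))) := by
    field_simp
    ring
  rw [abs_sub_comm, h, abs_of_nonneg (by positivity), ← mul_one (j / n)]
  gcongr
  · linarith
  · exact div_le_one_of_le₀ (by linarith) (by positivity)

theorem abs_choose_sub_le {n k j : ℕ} (hn : 0 < n) (hj : j ≤ k) :
    |((n + (k - j)).choose n : K) - (k / (n + k) : K) ^ j * (n + k).choose n| ≤
      (j : K) ^ 2 / n * (n + k).choose n := by
  induction j with
  | zero => simp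
  | succ j ih =>
    obtain ⟨m, rfl⟩ : ∃ m, k = m + (j + 1) := ⟨k - (j + 1), by lia⟩
    specialize ih (by lia)
    rw [show m + (j + 1) - j = m + 1 by lia] at ih
    rw [Nat.add_sub_cancel]
    have hn' : (0 : K) < n := by exact_mod_cast hn
    have hθs := abs_add_one_div_sub_add_div_le hn' m.cast_nonneg j.cast_nonneg
    have hb := cast_choose_eq_div_mul_choose_succ (K := K) n m
    push_cast at ih hb ⊢
    set s : K := (m + (j + 1)) / (n + (m + (j + 1)))
    set θ : K := (m + 1) / (n + m + 1)
    set c : K := ↑((n + (m + (j + 1))).choose n)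
    set b : K := ↑((n + (m + 1)).choose n)
    have hθ : |θ| ≤ 1 := by
      rw [abs_of_nonneg (by positivity)]
      exact div_le_one_of_le₀ (by linarith) (by positivity)
    have hs0 : 0 ≤ s := by positivity
    have hs1 : s ≤ 1 := div_le_one_of_le₀ (by linarith) (by positivity)
    calc |((n + m).choose n : K) - s ^ (j + 1) * c|
        = |θ * (b - s ^ j * c) + (θ - s) * (s ^ j * c)| := by rw [hb]; ring_nf
      _ ≤ |θ * (b - s ^ j * c)| + |(θ - s) * (s ^ j * c)| := abs_add_le _ _
      _ = |θ| * |b - s ^ j * c| + |θ - s| * (s ^ j * c) := by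
          rw [abs_mul, abs_mul, abs_of_nonneg (a := s ^ j * c) (by positivity)]
      _ ≤ 1 * (j ^ 2 / n * c) + j / n * (1 * c) := by gcongr; exact pow_le_one₀ hs0 hs1
      _ = (j ^ 2 + j) / n * c := by ring
      _ ≤ (j + 1 : K) ^ 2 / n * c := by gcongr; nlinarith

theorem abs_coeff_X_pow_mul_invOneSubPow_sub_le {n : ℕ} (hn : 0 < n) (j k : ℕ) :
    |coeff k ((X : K⟦X⟧) ^ j * (invOneSubPow K (n + 1)).val) -
        (k / (n + k) : K) ^ j * (n + k).choose n| ≤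
      (j : K) ^ 2 / n * (n + k).choose n := by
  rw [coeff_X_pow_mul', invOneSubPow_val_succ_eq_mk_add_choose, coeff_mk]
  split_ifs with hjk
  · exact abs_choose_sub_le hn hjk
  push Not at hjk
  have hn' : (0 : K) < n := by exact_mod_cast hn
  have hkj : (k : K) ≤ j := by exact_mod_cast hjk.le
  have hj : (1 : K) ≤ j := by exact_mod_cast (Nat.zero_le k).trans_lt hjk
  rw [zero_sub, abs_neg, abs_of_nonneg (by positivity)]
  gcongr
  calc (k / (n + k) : K) ^ j
      ≤ k / (n + k) := pow_le_of_le_one (by positivity)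
        (div_le_one_of_le₀ (by linarith) (by positivity)) (by lia)
    _ ≤ (j : K) ^ 2 / n := by gcongr <;> nlinarith

theorem abs_coeff_mul_invOneSubPow_sub_le {n : ℕ} (hn : 0 < n) (q : K[X]) (k : ℕ) :
    |coeff k ((q : K⟦X⟧) * (invOneSubPow K (n + 1)).val) -
        q.eval (k / (n + k) : K) * (n + k).choose n| ≤
      (q.sum fun j c => |c| * j ^ 2) / n * (n + k).choose n := by
  have hq : (q : K⟦X⟧) = ∑ j ∈ q.support, C (q.coeff j) * X ^ j := by
    simpa using congrArg Polynomial.coeToPowerSeries.ringHom q.as_sum_support_C_mul_X_pow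
  simp only [hq, Finset.sum_mul, map_sum, mul_assoc, coeff_C_mul, Polynomial.eval_eq_sum,
    Polynomial.sum, ← Finset.sum_sub_distrib, Finset.sum_div]
  refine (Finset.abs_sum_le_sum_abs _ _).trans (Finset.sum_le_sum fun j _ => ?_)
  rw [← mul_sub, abs_mul, mul_div_assoc, mul_assoc]
  gcongr
  exact abs_coeff_X_pow_mul_invOneSubPow_sub_le hn j k

theorem exists_coeff_mul_invOneSubPow_nonneg {q : ℝ[X]}
    (hq : ∀ t ∈ Set.Icc (0 : ℝ) 1, 0 < q.eval t) :
    ∃ n, ∀ k, 0 ≤ coeff k ((q : ℝ⟦X⟧) * (invOneSubPow ℝ (n + 1)).val) := by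
  obtain ⟨t₀, ht₀, hmin⟩ :=
    isCompact_Icc.exists_isMinOn (Set.nonempty_Icc.2 zero_le_one) q.continuousOn
  obtain ⟨n, hn⟩ := exists_nat_gt ((q.sum fun j c => |c| * j ^ 2) / q.eval t₀)
  have hn' : (0 : ℝ) < n := lt_of_le_of_lt
    (div_nonneg (Finset.sum_nonneg fun j _ => by positivity) (hq t₀ ht₀).le) hn
  refine ⟨n, fun k => ?_⟩
  have hlow : q.eval t₀ ≤ q.eval (k / (n + k) : ℝ) :=
    hmin ⟨by positivity, div_le_one_of_le₀ (by linarith) (by positivity)⟩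
  have herr : (q.sum fun j c => |c| * j ^ 2) / n ≤ q.eval t₀ :=
    ((div_lt_comm₀ (hq t₀ ht₀) hn').1 hn).le
  have h := abs_le.1 (abs_coeff_mul_invOneSubPow_sub_le (by exact_mod_cast hn') q k)
  have hdom : (q.sum fun j c => |c| * j ^ 2) / n * (n + k).choose n ≤
      q.eval (k / (n + k) : ℝ) * (n + k).choose n := by
    gcongr
    exact herr.trans hlow
  linarith [h.1]

theorem exists_gt_one_forall_Icc_pos {f : ℝ → ℝ} (hf : ContinuousAt f 1)
    (hpos : ∀ t ∈ Set.Icc (0 : ℝ) 1, 0 < f t) : ∃ ρ > 1, ∀ t ∈ Set.Icc (0 : ℝ) ρ, 0 < f t := by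
  obtain ⟨ε, hε, hball⟩ := Metric.eventually_nhds_iff.1
    (continuousAt_const.eventually_lt hf (hpos 1 (by simp)))
  refine ⟨1 + ε / 2, by linarith, fun t ht => ?_⟩
  rcases le_total t 1 with h1 | h1
  · exact hpos t ⟨ht.1, h1⟩
  · exact hball (by rw [Real.dist_eq, abs_of_nonneg (by linarith)]; linarith [ht.2])

theorem rescale_polynomial_comp_C_mul_X {K : Type*} [Field K] {r : K} (hr : r ≠ 0) (p : K[X]) :
    rescale r⁻¹ (p.comp (Polynomial.C r * Polynomial.X) : K⟦X⟧) = p := by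
  ext n
  rw [coeff_rescale, Polynomial.coeff_coe, Polynomial.comp_C_mul_X_coeff, Polynomial.coeff_coe,
    mul_left_comm, ← mul_pow, inv_mul_cancel₀ hr, one_pow, mul_one]

theorem exists_powerSeries_multiplier_nonneg {p : ℝ[X]}
    (hp : ∀ t ∈ Set.Icc (0 : ℝ) 1, 0 < p.eval t) :
    ∃ h : ℝ⟦X⟧, (∀ n, 0 ≤ coeff n h) ∧ coeff 0 h = 1 ∧
      (∃ R > 1, Summable fun n => coeff n h * R ^ n) ∧ ∀ n, 0 ≤ coeff n (h * p : ℝ⟦X⟧) := by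
  -- Positivity on `[0, ρ]` for some `ρ > 1` moves the pole of the multiplier from `1` to `ρ`, so
  -- that its coefficients decay geometrically.
  obtain ⟨ρ, hρ, hpρ⟩ := exists_gt_one_forall_Icc_pos p.continuousAt hp
  obtain ⟨R, hR, hRρ⟩ := exists_between hρ
  have hρ0 : 0 < ρ := one_pos.trans hρ
  set q : ℝ[X] := p.comp (Polynomial.C ρ * Polynomial.X) with hq
  have hqpos : ∀ t ∈ Set.Icc (0 : ℝ) 1, 0 < q.eval t := fun t ht => by
    simpa [hq] using hpρ (ρ * t) ⟨mul_nonneg hρ0.le ht.1, mul_le_of_le_one_right hρ0.le ht.2⟩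
  obtain ⟨d, hd⟩ := exists_coeff_mul_invOneSubPow_nonneg hqpos
  have hcoeff : ∀ n, coeff n (rescale ρ⁻¹ (invOneSubPow ℝ (d + 1)).val) =
      ρ⁻¹ ^ n * (n + d).choose d := fun n => by
    rw [coeff_rescale, invOneSubPow_val_succ_eq_mk_add_choose, coeff_mk, add_comm]
  refine ⟨rescale ρ⁻¹ (invOneSubPow ℝ (d + 1)).val, fun n => ?_, ?_, ⟨R, hR, ?_⟩, fun n => ?_⟩
  · rw [hcoeff]
    positivity
  · simp [hcoeff]
  · have hRρ' : ‖R / ρ‖ < 1 := by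
      rw [Real.norm_of_nonneg (by positivity)]
      exact (div_lt_one hρ0).2 hRρ
    refine (summable_choose_mul_geometric_of_norm_lt_one d hRρ').congr fun n => ?_
    rw [hcoeff, div_pow, inv_pow]
    ring
  · rw [← rescale_polynomial_comp_C_mul_X hρ0.ne' p, mul_comm, ← map_mul, coeff_rescale]
    exact mul_nonneg (by positivity) (hd n)

end Polya

section HereditaryForm

open PowerSeries

variable {𝕜 E F R : Type*} [NontriviallyNormedField 𝕜]
  [SeminormedAddCommGroup E] [NormedSpace 𝕜 E] [SeminormedAddCommGroup F] [NormedSpace 𝕜 F]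
  [NormedRing R]

/-- Boundedness of the quadratic form `x ↦ ∑ ‖aₙ‖ ‖Tⁿ x‖²`; when `E` is a Hilbert space this says
that the sums of the operators `‖aₙ‖ T*ⁿ Tⁿ` are uniformly bounded. -/
def HereditaryBounded (a : R⟦X⟧) (T : E →L[𝕜] E) : Prop :=
  ∃ C : ℝ, ∀ x N, ∑ n ∈ Finset.range N, ‖coeff n a‖ * ‖(T ^ n) x‖ ^ 2 ≤ C * ‖x‖ ^ 2

/-- The sum `∑ ‖Tⁿ x‖² aₙ`, which for a Hilbert space operator `T` is the quadratic form of the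
operator `a(T*, T) = ∑ aₙ T*ⁿ Tⁿ`. Meaningful when `HereditaryBounded a T`. -/
noncomputable def hereditaryForm [NormedAlgebra ℝ R] (a : R⟦X⟧) (T : E →L[𝕜] E) (x : E) : R :=
  ∑' n, ‖(T ^ n) x‖ ^ 2 • coeff n a

theorem hasSum_antidiagonal {A M : Type*} [AddMonoid A] [Finset.HasAntidiagonal A]
    [AddCommMonoid M] [TopologicalSpace M] [ContinuousAdd M] [RegularSpace M] {f : A × A → M}
    {s : M} (hf : HasSum f s) :
    HasSum (fun n => ∑ p ∈ Finset.HasAntidiagonal.antidiagonal n, f p) s := by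
  refine ((Finset.HasAntidiagonal.sigmaAntidiagonalEquivProd (A := A)).hasSum_iff.2 hf).sigma
    fun n => ?_
  rw [← Finset.sum_coe_sort]
  exact hasSum_fintype _

namespace HereditaryBounded

variable {a b : R⟦X⟧} {T : E →L[𝕜] E}

theorem summable_norm (ha : HereditaryBounded a T) (x : E) :
    Summable fun n => ‖coeff n a‖ * ‖(T ^ n) x‖ ^ 2 := by
  obtain ⟨C, hC⟩ := ha
  exact summable_of_sum_range_le (fun n => by positivity) (hC x)

theorem hasSum [NormedAlgebra ℝ R] [CompleteSpace R] (ha : HereditaryBounded a T) (x : E) :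
    HasSum (fun n => ‖(T ^ n) x‖ ^ 2 • coeff n a) (hereditaryForm a T x) := by
  refine (Summable.of_norm ((ha.summable_norm x).congr fun n => ?_)).hasSum
  rw [norm_smul, norm_pow, norm_norm, mul_comm]

theorem exists_tsum_le (ha : HereditaryBounded a T) : ∃ C : ℝ, 0 ≤ C ∧
    ∀ x, ∑' n, ‖coeff n a‖ * ‖(T ^ n) x‖ ^ 2 ≤ C * ‖x‖ ^ 2 := by
  obtain ⟨C, hC⟩ := ha
  refine ⟨max C 0, le_max_right _ _, fun x => ?_⟩
  refine (Real.tsum_le_of_sum_range_le (fun n => by positivity) (hC x)).trans ?_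
  gcongr
  exact le_max_left _ _

theorem sub (ha : HereditaryBounded a T) (hb : HereditaryBounded b T) :
    HereditaryBounded (a - b) T := by
  obtain ⟨A, hA⟩ := ha
  obtain ⟨B, hB⟩ := hb
  refine ⟨A + B, fun x N => ?_⟩
  rw [add_mul]
  refine le_trans ?_ (add_le_add (hA x N) (hB x N))
  rw [← Finset.sum_add_distrib]
  gcongr with n
  rw [← add_mul, map_sub]
  gcongr
  exact norm_sub_le _ _

theorem of_summable (hs : Summable fun n => ‖coeff n a‖ * ‖T ^ n‖ ^ 2) :
    HereditaryBounded a T := by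
  refine ⟨∑' n, ‖coeff n a‖ * ‖T ^ n‖ ^ 2, fun x N => ?_⟩
  calc ∑ n ∈ Finset.range N, ‖coeff n a‖ * ‖(T ^ n) x‖ ^ 2
      ≤ ∑ n ∈ Finset.range N, ‖coeff n a‖ * (‖T ^ n‖ * ‖x‖) ^ 2 := by
        gcongr with n
        exact (T ^ n).le_opNorm x
    _ = (∑ n ∈ Finset.range N, ‖coeff n a‖ * ‖T ^ n‖ ^ 2) * ‖x‖ ^ 2 := by
        simp only [mul_pow, Finset.sum_mul, mul_assoc]
    _ ≤ (∑' n, ‖coeff n a‖ * ‖T ^ n‖ ^ 2) * ‖x‖ ^ 2 := by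
        gcongr
        exact hs.sum_le_tsum _ fun n _ => by positivity

theorem coe_polynomial (p : Polynomial R) : HereditaryBounded (p : R⟦X⟧) T :=
  of_summable (summable_of_ne_finset_zero (s := p.support) fun n hn => by
    rw [Polynomial.coeff_coe, Polynomial.notMem_support_iff.1 hn, norm_zero, zero_mul])

theorem exists_hasSum_mul (ha : HereditaryBounded a T) (hb : HereditaryBounded b T) :
    ∃ C : ℝ, ∀ x, ∃ s ≤ C * ‖x‖ ^ 2, HasSum (fun p : ℕ × ℕ =>
      ‖coeff p.1 a‖ * ‖coeff p.2 b‖ * ‖(T ^ (p.1 + p.2)) x‖ ^ 2) s := by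
  obtain ⟨A, -, hA⟩ := ha.exists_tsum_le
  obtain ⟨B, hB0, hB⟩ := hb.exists_tsum_le
  refine ⟨B * A, fun x => ?_⟩
  have hpow : ∀ i j, ‖coeff i a‖ * ‖coeff j b‖ * ‖(T ^ (i + j)) x‖ ^ 2 =
      ‖coeff i a‖ * (‖coeff j b‖ * ‖(T ^ j) ((T ^ i) x)‖ ^ 2) := fun i j => by
    rw [add_comm, pow_add, mul_apply_eq_comp, mul_assoc]
  have hinner : ∀ i, ∑' j, ‖coeff i a‖ * ‖coeff j b‖ * ‖(T ^ (i + j)) x‖ ^ 2 ≤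
      B * (‖coeff i a‖ * ‖(T ^ i) x‖ ^ 2) := fun i => by
    simp only [hpow, tsum_mul_left]
    rw [mul_left_comm]
    gcongr
    exact hB _
  have houter : Summable fun i => ∑' j, ‖coeff i a‖ * ‖coeff j b‖ * ‖(T ^ (i + j)) x‖ ^ 2 :=
    Summable.of_nonneg_of_le (fun i => tsum_nonneg fun j => by positivity) hinner
      ((ha.summable_norm x).mul_left B)
  have hs : Summable fun p : ℕ × ℕ =>
      ‖coeff p.1 a‖ * ‖coeff p.2 b‖ * ‖(T ^ (p.1 + p.2)) x‖ ^ 2 := by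
    refine (summable_prod_of_nonneg fun p => by positivity).2 ⟨fun i => ?_, houter⟩
    simp only [hpow]
    exact (hb.summable_norm _).mul_left _
  refine ⟨_, ?_, hs.hasSum⟩
  calc _ = ∑' i, ∑' j, ‖coeff i a‖ * ‖coeff j b‖ * ‖(T ^ (i + j)) x‖ ^ 2 := hs.tsum_prod
    _ ≤ ∑' i, B * (‖coeff i a‖ * ‖(T ^ i) x‖ ^ 2) :=
        houter.tsum_le_tsum hinner ((ha.summable_norm x).mul_left B)
    _ ≤ B * (A * ‖x‖ ^ 2) := by
        rw [tsum_mul_left]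
        gcongr
        exact hA x
    _ = B * A * ‖x‖ ^ 2 := by ring

theorem mul (ha : HereditaryBounded a T) (hb : HereditaryBounded b T) :
    HereditaryBounded (a * b) T := by
  obtain ⟨C, hC⟩ := ha.exists_hasSum_mul hb
  refine ⟨C, fun x N => ?_⟩
  obtain ⟨s, hsC, hs⟩ := hC x
  calc ∑ n ∈ Finset.range N, ‖coeff n (a * b)‖ * ‖(T ^ n) x‖ ^ 2
      ≤ ∑ n ∈ Finset.range N, ∑ p ∈ Finset.HasAntidiagonal.antidiagonal n,
          ‖coeff p.1 a‖ * ‖coeff p.2 b‖ * ‖(T ^ (p.1 + p.2)) x‖ ^ 2 := by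
        gcongr with n
        rw [coeff_mul]
        refine (mul_le_mul_of_nonneg_right (norm_sum_le _ _) (by positivity)).trans ?_
        rw [Finset.sum_mul]
        gcongr with p hp
        · exact norm_mul_le _ _
        · rw [Finset.HasAntidiagonal.mem_antidiagonal.1 hp]
    _ ≤ s := sum_le_hasSum _ (fun n _ => by positivity) (hasSum_antidiagonal hs)
    _ ≤ C * ‖x‖ ^ 2 := hsC

theorem hasSum_hereditaryForm_mul [NormedAlgebra ℝ R] [CompleteSpace R]
    (ha : HereditaryBounded a T) (hb : HereditaryBounded b T) (x : E) :
    HasSum (fun n => coeff n a * hereditaryForm b T ((T ^ n) x)) (hereditaryForm (a * b) T x) := by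
  obtain ⟨C, hC⟩ := ha.exists_hasSum_mul hb
  obtain ⟨s, -, hs⟩ := hC x
  have hsum : Summable fun p : ℕ × ℕ =>
      ‖(T ^ (p.1 + p.2)) x‖ ^ 2 • (coeff p.1 a * coeff p.2 b) :=
    Summable.of_norm_bounded hs.summable fun p => by
      rw [norm_smul, norm_pow, norm_norm, mul_comm]
      gcongr
      exact norm_mul_le _ _
  have hdiag := hasSum_antidiagonal hsum.hasSum
  have hcoeff : ∀ n, ∑ p ∈ Finset.HasAntidiagonal.antidiagonal n,
      ‖(T ^ (p.1 + p.2)) x‖ ^ 2 • (coeff p.1 a * coeff p.2 b) =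
        ‖(T ^ n) x‖ ^ 2 • coeff n (a * b) := fun n => by
    rw [coeff_mul, Finset.smul_sum]
    exact Finset.sum_congr rfl fun p hp => by rw [Finset.HasAntidiagonal.mem_antidiagonal.1 hp]
  simp only [hcoeff] at hdiag
  rw [((ha.mul hb).hasSum x).unique hdiag]
  refine hsum.hasSum.prod_fiberwise fun i => ?_
  refine ((hb.hasSum ((T ^ i) x)).mul_left (coeff i a)).congr_fun fun j => ?_
  rw [mul_smul_comm, add_comm, pow_add, mul_apply_eq_comp]

theorem hereditaryForm_sub [NormedAlgebra ℝ R] [CompleteSpace R]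
    (ha : HereditaryBounded a T) (hb : HereditaryBounded b T) (x : E) :
    hereditaryForm (a - b) T x = hereditaryForm a T x - hereditaryForm b T x := by
  simpa only [hereditaryForm, map_sub, smul_sub] using (ha.hasSum x).sub (hb.hasSum x) |>.tsum_eq

theorem norm_hereditaryForm_le [NormedAlgebra ℝ R] (ha : HereditaryBounded a T) (x : E) :
    ‖hereditaryForm a T x‖ ≤ ∑' n, ‖coeff n a‖ * ‖(T ^ n) x‖ ^ 2 :=
  tsum_of_norm_bounded (ha.summable_norm x).hasSum fun n => by
    rw [norm_smul, norm_pow, norm_norm, mul_comm]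

theorem hereditaryForm_mul_nonneg [NormedAlgebra ℝ R] [CompleteSpace R] [PartialOrder R]
    [IsOrderedRing R] [OrderClosedTopology R] (ha : HereditaryBounded a T)
    (hb : HereditaryBounded b T) (ha₀ : ∀ n, 0 ≤ coeff n a) (hb₀ : ∀ x, 0 ≤ hereditaryForm b T x)
    (x : E) : 0 ≤ hereditaryForm (a * b) T x :=
  (ha.hasSum_hereditaryForm_mul hb x).nonneg fun n => mul_nonneg (ha₀ n) (hb₀ _)

theorem coeff_zero_mul_hereditaryForm_le [NormedAlgebra ℝ R] [CompleteSpace R] [PartialOrder R]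
    [IsOrderedRing R] [OrderClosedTopology R] (ha : HereditaryBounded a T)
    (hb : HereditaryBounded b T) (ha₀ : ∀ n, 0 ≤ coeff n a) (hb₀ : ∀ x, 0 ≤ hereditaryForm b T x)
    (x : E) : coeff 0 a * hereditaryForm b T x ≤ hereditaryForm (a * b) T x := by
  simpa only [pow_zero, one_apply_eq_self] using le_hasSum (ha.hasSum_hereditaryForm_mul hb x) 0
    fun n _ => mul_nonneg (ha₀ n) (hb₀ _)

theorem map_algebraMap [NormedAlgebra ℝ R] [NormOneClass R] {c : ℝ⟦X⟧}
    (hc : HereditaryBounded c T) : HereditaryBounded (c.map (algebraMap ℝ R)) T := by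
  simpa only [HereditaryBounded, coeff_map, norm_algebraMap'] using hc

theorem hereditaryForm_map_algebraMap [NormedAlgebra ℝ R] {c : ℝ⟦X⟧}
    (hc : HereditaryBounded c T) (x : E) :
    hereditaryForm (c.map (algebraMap ℝ R)) T x = algebraMap ℝ R (hereditaryForm c T x) := by
  refine ((hc.hasSum x).map (algebraMap ℝ R) (algebraMapCLM ℝ R).continuous).tsum_eq.symm ▸ ?_
  simp [hereditaryForm, Algebra.smul_def]

theorem conj (ha : HereditaryBounded a T) (V : E ≃L[𝕜] F) :
    HereditaryBounded a (V.conjContinuousAlgEquiv T) := by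
  obtain ⟨C, hC0, hC⟩ := ha.exists_tsum_le
  refine ⟨‖(V : E →L[𝕜] F)‖ ^ 2 * (C * ‖(V.symm : F →L[𝕜] E)‖ ^ 2), fun y N => ?_⟩
  calc ∑ n ∈ Finset.range N, ‖coeff n a‖ * ‖((V.conjContinuousAlgEquiv T) ^ n) y‖ ^ 2
      ≤ ∑ n ∈ Finset.range N,
          ‖coeff n a‖ * (‖(V : E →L[𝕜] F)‖ * ‖(T ^ n) (V.symm y)‖) ^ 2 := by
        gcongr with n
        rw [← map_pow]
        exact (V : E →L[𝕜] F).le_opNorm _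
    _ = ‖(V : E →L[𝕜] F)‖ ^ 2 *
          ∑ n ∈ Finset.range N, ‖coeff n a‖ * ‖(T ^ n) (V.symm y)‖ ^ 2 := by
        simp only [mul_pow, Finset.mul_sum, mul_left_comm]
    _ ≤ ‖(V : E →L[𝕜] F)‖ ^ 2 * (C * ‖V.symm y‖ ^ 2) := by
        gcongr
        exact ((ha.summable_norm _).sum_le_tsum _ fun n _ => by positivity).trans (hC _)
    _ ≤ ‖(V : E →L[𝕜] F)‖ ^ 2 * (C * (‖(V.symm : F →L[𝕜] E)‖ * ‖y‖) ^ 2) := by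
        gcongr
        exact (V.symm : F →L[𝕜] E).le_opNorm y
    _ = _ := by ring

theorem hereditaryForm_conj [NormedAlgebra ℝ R] [CompleteSpace R] [NormOneClass R] {c : ℝ⟦X⟧}
    (ha : HereditaryBounded a T) (hc : HereditaryBounded c T) {V : E ≃L[𝕜] F}
    (hV : ∀ x, ‖V x‖ ^ 2 = hereditaryForm c T x) (x : E) :
    hereditaryForm a (V.conjContinuousAlgEquiv T) (V x) =
      hereditaryForm (a * c.map (algebraMap ℝ R)) T x := by
  refine HasSum.tsum_eq ((ha.hasSum_hereditaryForm_mul hc.map_algebraMap x).congr_fun fun n => ?_)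
  rw [← map_pow, ContinuousLinearEquiv.conjContinuousAlgEquiv_apply_apply, V.symm_apply_apply, hV,
    hc.hereditaryForm_map_algebraMap, Algebra.smul_def, Algebra.commutes]

end HereditaryBounded

theorem hereditaryForm_C [NormedAlgebra ℝ R] (r : R) (T : E →L[𝕜] E) (x : E) :
    hereditaryForm (C r) T x = ‖x‖ ^ 2 • r := by
  rw [hereditaryForm, tsum_eq_single 0 fun n hn => by rw [coeff_C, if_neg hn, smul_zero],
    coeff_zero_C, pow_zero, one_apply_eq_self]

theorem eventually_norm_pow_lt_pow_of_spectralRadius_lt {A : Type*} [NormedRing A]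
    [NormedAlgebra ℂ A] [CompleteSpace A] {a : A} {r : NNReal} (ha : spectralRadius ℂ a < r) :
    ∀ᶠ n : ℕ in atTop, ‖a ^ n‖ < r ^ n := by
  have hroot := spectrum.pow_nnnorm_pow_one_div_tendsto_nhds_spectralRadius a
  filter_upwards [hroot.eventually_lt_const ha, eventually_gt_atTop 0] with n hn hn0
  rw [one_div, ENNReal.rpow_inv_lt_iff (by exact_mod_cast hn0), ENNReal.rpow_natCast] at hn
  exact_mod_cast hn

theorem HereditaryBounded.of_summable_mul_pow {E R : Type*} [NormedAddCommGroup E]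
    [NormedSpace ℂ E] [CompleteSpace E] [NormedRing R] {T : E →L[ℂ] E} {a : R⟦X⟧}
    {ρ : ℝ} (hρ : 1 < ρ) (hT : spectrum ℂ T ⊆ Metric.closedBall 0 1)
    (hs : Summable fun n => ‖coeff n a‖ * ρ ^ n) :
    HereditaryBounded a T := by
  have hr : spectralRadius ℂ T ≤ 1 := iSup₂_le fun z hz => by
    exact_mod_cast mem_closedBall_zero_iff.1 (hT hz)
  set r : NNReal := ⟨√ρ, ρ.sqrt_nonneg⟩
  have hlt : spectralRadius ℂ T < r := hr.trans_lt (by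
    rw [ENNReal.one_lt_coe_iff, ← NNReal.coe_lt_coe]
    exact Real.lt_sqrt_of_sq_lt (by simpa using hρ))
  refine of_summable (Summable.of_norm_bounded_eventually_nat hs ?_)
  filter_upwards [eventually_norm_pow_lt_pow_of_spectralRadius_lt hlt] with n hn
  rw [norm_mul, norm_norm, norm_pow, norm_norm]
  gcongr
  calc ‖T ^ n‖ ^ 2 ≤ (√ρ ^ n) ^ 2 := by gcongr; exact hn.le
    _ = ρ ^ n := by rw [← pow_mul, mul_comm, pow_mul, Real.sq_sqrt (by linarith)]

end HereditaryForm

section HilbertSpace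

open PowerSeries
open scoped ComplexOrder

variable {H : Type*} [NormedAddCommGroup H] [InnerProductSpace ℂ H] {A : H →L[ℂ] H}

theorem re_inner_self_apply_le (A : H →L[ℂ] H) (x : H) :
    (inner ℂ x (A x)).re ≤ ‖A‖ * ‖x‖ ^ 2 :=
  calc (inner ℂ x (A x)).re ≤ ‖x‖ * ‖A x‖ := re_inner_le_norm (𝕜 := ℂ) x (A x)
    _ ≤ ‖x‖ * (‖A‖ * ‖x‖) := by gcongr; exact A.le_opNorm x
    _ = ‖A‖ * ‖x‖ ^ 2 := by ring

theorem isPositive_iff_forall_inner_nonneg :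
    A.IsPositive ↔ ∀ x, 0 ≤ inner ℂ x (A x) := by
  refine ⟨fun hA => hA.inner_nonneg_right, fun hA => ?_⟩
  refine (ContinuousLinearMap.isPositive_iff_complex A).2 fun x => ?_
  have hx : 0 ≤ inner ℂ (A x) x := by
    rw [← inner_conj_symm]
    exact star_nonneg_iff.2 (hA x)
  exact ⟨Complex.ext rfl (Complex.nonneg_iff.1 hx).2, (Complex.nonneg_iff.1 hx).1⟩

variable [CompleteSpace H] {R : Type*} [NormedRing R] {c : ℕ → ℂ} {a : ℂ⟦X⟧} {b : R⟦X⟧}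
  {T : H →L[ℂ] H}

theorem inner_adjoint_pow_mul_pow (T : H →L[ℂ] H) (n : ℕ) (x y : H) :
    inner ℂ x ((T.adjoint ^ n * T ^ n) y) = inner ℂ ((T ^ n) x) ((T ^ n) y) := by
  rw [← ContinuousLinearMap.star_eq_adjoint, ← star_pow, ContinuousLinearMap.star_eq_adjoint,
    mul_apply_eq_comp, ContinuousLinearMap.adjoint_inner_right]

theorem inner_hereditaryPartialSum (c : ℕ → ℂ) (T : H →L[ℂ] H) (N : ℕ) (x : H) :
    inner ℂ x (hereditaryPartialSum c T N x) =
      ∑ n ∈ Finset.range N, ‖(T ^ n) x‖ ^ 2 • c n := by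
  rw [hereditaryPartialSum, sum_apply, inner_sum]
  refine Finset.sum_congr rfl fun n _ => ?_
  rw [smul_apply, inner_smul_right, inner_adjoint_pow_mul_pow, inner_self_eq_norm_sq_to_K,
    mul_comm, Complex.real_smul]
  norm_cast

namespace HasHereditarySumSOT

theorem tendsto_inner (hA : HasHereditarySumSOT c T A) (x : H) :
    Tendsto (fun N => ∑ n ∈ Finset.range N, ‖(T ^ n) x‖ ^ 2 • c n) atTop
      (𝓝 (inner ℂ x (A x))) := by
  simpa only [inner_hereditaryPartialSum] using
    (tendsto_const_nhds (x := x)).inner (𝕜 := ℂ) (hA x)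

theorem hasSum_norm (hA : HasHereditarySumSOT (fun n => (‖coeff n b‖ : ℂ)) T A) (x : H) :
    HasSum (fun n => ‖coeff n b‖ * ‖(T ^ n) x‖ ^ 2) (inner ℂ x (A x)).re := by
  refine (hasSum_iff_tendsto_nat_of_nonneg (fun n => by positivity) _).2 ?_
  refine ((Complex.continuous_re.tendsto _).comp (hA.tendsto_inner x)).congr fun N => ?_
  rw [Function.comp_apply, Complex.re_sum]
  refine Finset.sum_congr rfl fun n _ => ?_
  rw [Complex.smul_re, Complex.ofReal_re, smul_eq_mul, mul_comm]

theorem hereditaryBounded (hA : HasHereditarySumSOT (fun n => (‖coeff n b‖ : ℂ)) T A) :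
    HereditaryBounded b T :=
  ⟨‖A‖, fun x _ => (sum_le_hasSum _ (fun _ _ => by positivity) (hA.hasSum_norm x)).trans
    (re_inner_self_apply_le A x)⟩

theorem inner_eq (hA : HasHereditarySumSOT (fun n => coeff n a) T A)
    (ha : HereditaryBounded a T) (x : H) : inner ℂ x (A x) = hereditaryForm a T x :=
  tendsto_nhds_unique (hA.tendsto_inner x) (ha.hasSum x).tendsto_sum_nat

end HasHereditarySumSOT

theorem HasHereditarySumNorm.hasHereditarySumSOT (hA : HasHereditarySumNorm c T A) :
    HasHereditarySumSOT c T A := fun x =>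
  ((ContinuousLinearMap.apply ℂ H x).continuous.tendsto A).comp hA

theorem HasHereditarySumNorm.eventually_tsum_sub_trunc_le
    (hA : HasHereditarySumNorm (fun n => (‖coeff n b‖ : ℂ)) T A) {ε : ℝ} (hε : 0 < ε) :
    ∀ᶠ N in atTop, ∀ x,
      ∑' n, ‖coeff n (b - (b.trunc N : R⟦X⟧))‖ * ‖(T ^ n) x‖ ^ 2 ≤ ε * ‖x‖ ^ 2 := by
  filter_upwards [hA.eventually (Metric.ball_mem_nhds A hε)] with N hN x
  set S := hereditaryPartialSum (fun n => (‖coeff n b‖ : ℂ)) T N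
  have hinit : HasSum (fun n => ‖coeff n (b.trunc N : R⟦X⟧)‖ * ‖(T ^ n) x‖ ^ 2)
      (inner ℂ x (S x)).re := by
    have hsum : (inner ℂ x (S x)).re =
        ∑ n ∈ Finset.range N, ‖coeff n (b.trunc N : R⟦X⟧)‖ * ‖(T ^ n) x‖ ^ 2 := by
      rw [inner_hereditaryPartialSum, Complex.re_sum]
      refine Finset.sum_congr rfl fun n hn => ?_
      rw [Polynomial.coeff_coe, coeff_trunc, if_pos (Finset.mem_range.1 hn), Complex.smul_re,
        Complex.ofReal_re, smul_eq_mul, mul_comm]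
    rw [hsum]
    refine hasSum_sum_of_ne_finset_zero fun n hn => ?_
    rw [Polynomial.coeff_coe, coeff_trunc, if_neg (mt Finset.mem_range.2 hn), norm_zero, zero_mul]
  have htail : HasSum (fun n => ‖coeff n (b - (b.trunc N : R⟦X⟧))‖ * ‖(T ^ n) x‖ ^ 2)
      (inner ℂ x ((A - S) x)).re := by
    rw [sub_apply, inner_sub_right, Complex.sub_re]
    refine ((hA.hasHereditarySumSOT.hasSum_norm x).sub hinit).congr_fun fun n => ?_
    rw [map_sub, Polynomial.coeff_coe, coeff_trunc]
    split_ifs <;> simp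
  rw [htail.tsum_eq]
  refine (re_inner_self_apply_le (A - S) x).trans ?_
  gcongr
  rw [← dist_eq_norm, dist_comm]
  exact (Metric.mem_ball.1 hN).le

theorem norm_inner_sum_adjoint_pow_mul_pow_sq_le (a : ℂ⟦X⟧) (T : H →L[ℂ] H) (t : Finset ℕ)
    (x y : H) :
    ‖inner ℂ y (∑ n ∈ t, coeff n a • (T.adjoint ^ n * T ^ n) x)‖ ^ 2 ≤
      (∑ n ∈ t, ‖coeff n a‖ * ‖(T ^ n) y‖ ^ 2) * ∑ n ∈ t, ‖coeff n a‖ * ‖(T ^ n) x‖ ^ 2 := by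
  have hle : ‖inner ℂ y (∑ n ∈ t, coeff n a • (T.adjoint ^ n * T ^ n) x)‖ ≤
      ∑ n ∈ t, ‖coeff n a‖ * (‖(T ^ n) y‖ * ‖(T ^ n) x‖) := by
    rw [inner_sum]
    refine (norm_sum_le _ _).trans ?_
    gcongr with n
    rw [inner_smul_right, inner_adjoint_pow_mul_pow, norm_mul]
    gcongr
    exact norm_inner_le_norm _ _
  refine (pow_le_pow_left₀ (norm_nonneg _) hle 2).trans ?_
  exact Finset.sum_sq_le_sum_mul_sum_of_sq_le_mul t (fun n _ => by positivity)
    (fun n _ => by positivity) fun n _ => le_of_eq (by ring)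

namespace HereditaryBounded

theorem exists_norm_sum_sq_le (ha : HereditaryBounded a T) :
    ∃ C > 0, ∀ (t : Finset ℕ) (x : H), ‖∑ n ∈ t, coeff n a • (T.adjoint ^ n * T ^ n) x‖ ^ 2 ≤
      C * ∑ n ∈ t, ‖coeff n a‖ * ‖(T ^ n) x‖ ^ 2 := by
  obtain ⟨C, hC0, hC⟩ := ha.exists_tsum_le
  refine ⟨C + 1, by positivity, fun t x => ?_⟩
  set v := ∑ n ∈ t, coeff n a • (T.adjoint ^ n * T ^ n) x
  rcases eq_or_ne v 0 with hv | hv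
  · rw [hv, norm_zero, zero_pow two_ne_zero]
    positivity
  have hvC : ∑ n ∈ t, ‖coeff n a‖ * ‖(T ^ n) v‖ ^ 2 ≤ C * ‖v‖ ^ 2 :=
    ((ha.summable_norm v).sum_le_tsum t fun n _ => by positivity).trans (hC v)
  refine le_of_mul_le_mul_left ?_ (show 0 < ‖v‖ ^ 2 by positivity)
  calc ‖v‖ ^ 2 * ‖v‖ ^ 2 = ‖inner ℂ v v‖ ^ 2 := by
        rw [inner_self_eq_norm_sq_to_K]
        simp [sq]
    _ ≤ (C * ‖v‖ ^ 2) * ∑ n ∈ t, ‖coeff n a‖ * ‖(T ^ n) x‖ ^ 2 :=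
        (norm_inner_sum_adjoint_pow_mul_pow_sq_le a T t x v).trans (by gcongr)
    _ ≤ ‖v‖ ^ 2 * ((C + 1) * ∑ n ∈ t, ‖coeff n a‖ * ‖(T ^ n) x‖ ^ 2) := by
        rw [mul_comm C, mul_assoc]
        gcongr
        linarith

theorem summable_smul_adjoint_pow_mul_pow_apply (ha : HereditaryBounded a T) (x : H) :
    Summable fun n => coeff n a • (T.adjoint ^ n * T ^ n) x := by
  obtain ⟨C, hC0, hC⟩ := ha.exists_norm_sum_sq_le
  refine summable_iff_vanishing_norm.2 fun ε hε => ?_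
  obtain ⟨s, hs⟩ := summable_iff_vanishing_norm.1 (ha.summable_norm x) (ε ^ 2 / C) (by positivity)
  refine ⟨s, fun t ht => lt_of_pow_lt_pow_left₀ 2 hε.le ((hC t x).trans_lt ?_)⟩
  rw [mul_comm, ← lt_div_iff₀ hC0]
  exact (Real.le_norm_self _).trans_lt (hs t ht)

theorem exists_hasHereditarySumSOT (ha : HereditaryBounded a T) :
    ∃ A : H →L[ℂ] H, HasHereditarySumSOT (fun n => coeff n a) T A := by
  have hlim : Tendsto (fun N x => hereditaryPartialSum (fun n => coeff n a) T N x) atTop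
      (𝓝 fun x => ∑' n, coeff n a • (T.adjoint ^ n * T ^ n) x) := by
    refine tendsto_pi_nhds.2 fun x => ?_
    refine (ha.summable_smul_adjoint_pow_mul_pow_apply x).hasSum.tendsto_sum_nat.congr fun N => ?_
    simp only [hereditaryPartialSum, sum_apply, smul_apply]
  exact ⟨continuousLinearMapOfTendsto _ hlim, fun x => tendsto_pi_nhds.1 hlim x⟩

end HereditaryBounded

theorem exists_equiv_norm_sq_eq_of_inner_eq {q : H → ℝ} {δ : ℝ} (hδ : 0 < δ)
    (hq : ∀ x, δ * ‖x‖ ^ 2 ≤ q x) (hA : ∀ x, inner ℂ x (A x) = (q x : ℂ)) :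
    ∃ V : H ≃L[ℂ] H, ∀ x, ‖V x‖ ^ 2 = q x := by
  have hq₀ : ∀ x, 0 ≤ q x := fun x => le_trans (by positivity) (hq x)
  have hpos : A.IsPositive := isPositive_iff_forall_inner_nonneg.2 fun x => by
    rw [hA]
    exact Complex.zero_le_real.2 (hq₀ x)
  have hunit : IsUnit A :=
    A.isUnit_of_forall_le_norm_inner_map (c := ⟨δ, hδ.le⟩) hδ fun x => by
      rw [hpos.inner_left_eq_inner_right, hA, Complex.norm_real, Real.norm_of_nonneg (hq₀ x),
        mul_comm]
      exact hq x
  obtain ⟨B, hB, rfl⟩ := CStarAlgebra.isStrictlyPositive_iff_eq_star_mul_self.1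
    (hunit.isStrictlyPositive ((ContinuousLinearMap.nonneg_iff_isPositive A).2 hpos))
  refine ⟨ContinuousLinearEquiv.unitsEquiv ℂ H hB.unit, fun x => ?_⟩
  have hB' : inner ℂ (B x) (B x) = (q x : ℂ) := by
    rw [← ContinuousLinearMap.adjoint_inner_right, ← ContinuousLinearMap.star_eq_adjoint,
      ← mul_apply_eq_comp, hA]
  rw [inner_self_eq_norm_sq_to_K] at hB'
  change ‖B x‖ ^ 2 = q x
  exact Complex.ofReal_injective (by simpa using hB')

end HilbertSpace

section TaylorSeries

open PowerSeries
open scoped ComplexOrder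

/-- The Taylor series of `f` at the origin, as a formal power series. -/
noncomputable def taylorSeries (f : ℂ → ℂ) : ℂ⟦X⟧ := mk (taylorCoeff f)

theorem coeff_taylorSeries (f : ℂ → ℂ) (n : ℕ) : coeff n (taylorSeries f) = taylorCoeff f n :=
  coeff_mk n _

theorem taylorSeries_congr {f g : ℂ → ℂ} (hfg : f =ᶠ[𝓝 0] g) :
    taylorSeries f = taylorSeries g := by
  ext n
  rw [coeff_taylorSeries, coeff_taylorSeries, taylorCoeff, taylorCoeff,
    (hfg.iteratedDeriv n).self_of_nhds]

theorem taylorSeries_mul {f g : ℂ → ℂ} (hf : AnalyticAt ℂ f 0) (hg : AnalyticAt ℂ g 0) :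
    taylorSeries (f * g) = taylorSeries f * taylorSeries g := by
  ext n
  simp only [coeff_mul, coeff_taylorSeries]
  rw [taylorCoeff, iteratedDeriv_mul hf.contDiffAt hg.contDiffAt, Finset.sum_div,
    Finset.Nat.sum_antidiagonal_eq_sum_range_succ fun i j => taylorCoeff f i * taylorCoeff g j]
  refine Finset.sum_congr rfl fun i hi => ?_
  rw [taylorCoeff, taylorCoeff, Nat.cast_choose ℂ (Finset.mem_range_succ_iff.1 hi)]
  have hn : (n.factorial : ℂ) ≠ 0 := Nat.cast_ne_zero.2 n.factorial_ne_zero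
  field_simp

theorem analyticAt_of_mem_wienerAlgebra {f : ℂ → ℂ} (hf : f ∈ WienerAlgebra) :
    AnalyticAt ℂ f 0 := by
  refine ⟨FormalMultilinearSeries.ofScalars ℂ (taylorCoeff f), (1 : NNReal), ?_,
    by exact_mod_cast one_pos, fun {z} hz => ?_⟩
  · refine FormalMultilinearSeries.le_radius_of_summable _ (hf.1.congr fun n => ?_)
    rw [FormalMultilinearSeries.ofScalars_norm, NNReal.coe_one, one_pow, mul_one]
  · rw [Metric.eball_coe] at hz
    simpa only [zero_add, FormalMultilinearSeries.ofScalars_apply_eq, smul_eq_mul] using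
      hf.2 z (Metric.ball_subset_closedBall hz)

theorem hereditaryNonneg_iff {H : Type*} [NormedAddCommGroup H] [InnerProductSpace ℂ H]
    [CompleteSpace H] {f : ℂ → ℂ} {T : H →L[ℂ] H} (hf : HereditaryBounded (taylorSeries f) T) :
    HereditaryNonneg f T ↔ ∀ x, 0 ≤ hereditaryForm (taylorSeries f) T x := by
  have hcoeff : taylorCoeff f = fun n => coeff n (taylorSeries f) :=
    funext fun n => (coeff_taylorSeries f n).symm
  rw [HereditaryNonneg, hcoeff]
  constructor
  · rintro ⟨A, hA, hpos⟩ x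
    exact hA.inner_eq hf x ▸ hpos.inner_nonneg_right x
  · intro h
    obtain ⟨A, hA⟩ := hf.exists_hasHereditarySumSOT
    exact ⟨A, hA, isPositive_iff_forall_inner_nonneg.2 fun x => (hA.inner_eq hf x).symm ▸ h x⟩

theorem exists_map_algebraMap_eq_taylorSeries {f : ℂ → ℂ} (hf : ∀ n, (taylorCoeff f n).im = 0) :
    ∃ g : ℝ⟦X⟧, g.map (algebraMap ℝ ℂ) = taylorSeries f := by
  refine ⟨mk fun n => (taylorCoeff f n).re, ?_⟩
  ext n
  rw [coeff_map, coeff_mk, coeff_taylorSeries]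
  exact Complex.ext rfl (hf n).symm

theorem norm_taylorCoeff_eq {f : ℂ → ℂ} {g : ℝ⟦X⟧} (hg : g.map (algebraMap ℝ ℂ) = taylorSeries f)
    (n : ℕ) : ‖taylorCoeff f n‖ = ‖coeff n g‖ := by
  rw [← coeff_taylorSeries, ← hg, coeff_map, norm_algebraMap']

theorem hasSum_coeff_mul_pow {f : ℂ → ℂ} (hf : f ∈ WienerAlgebra) {g : ℝ⟦X⟧}
    (hg : g.map (algebraMap ℝ ℂ) = taylorSeries f) {t : ℝ} (ht : t ∈ Set.Icc (0 : ℝ) 1) :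
    HasSum (fun n => coeff n g * t ^ n) (f t).re := by
  have ht' : (t : ℂ) ∈ Metric.closedBall (0 : ℂ) 1 := by
    rw [mem_closedBall_zero_iff, Complex.norm_real, Real.norm_of_nonneg ht.1]
    exact ht.2
  refine (Complex.hasSum_re (hf.2 t ht')).congr_fun fun n => ?_
  rw [← coeff_taylorSeries, ← hg, coeff_map, Complex.coe_algebraMap]
  norm_cast

theorem exists_lt_eval_trunc {g : ℝ⟦X⟧} (hs : Summable fun n => ‖coeff n g‖)
    (hpos : ∀ t ∈ Set.Icc (0 : ℝ) 1, 0 < ∑' n, coeff n g * t ^ n) :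
    ∃ δ > 0, ∀ᶠ N in atTop, ∀ t ∈ Set.Icc (0 : ℝ) 1, δ < (g.trunc N).eval t := by
  have hbound : ∀ n, ∀ t ∈ Set.Icc (0 : ℝ) 1, ‖coeff n g * t ^ n‖ ≤ ‖coeff n g‖ := fun n t ht => by
    rw [norm_mul, norm_pow, Real.norm_of_nonneg ht.1]
    exact mul_le_of_le_one_right (norm_nonneg _) (pow_le_one₀ ht.1 ht.2)
  have hcont : ContinuousOn (fun t : ℝ => ∑' n, coeff n g * t ^ n) (Set.Icc 0 1) :=
    continuousOn_tsum (fun n => by fun_prop) hs hbound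
  obtain ⟨t₀, ht₀, hmin⟩ := isCompact_Icc.exists_isMinOn (Set.nonempty_Icc.2 zero_le_one) hcont
  have hδ := half_pos (hpos t₀ ht₀)
  refine ⟨_, hδ, ?_⟩
  filter_upwards [Metric.tendstoUniformlyOn_iff.1 (tendstoUniformlyOn_tsum_nat hs hbound) _ hδ]
    with N hN t ht
  have heval : (g.trunc N).eval t = ∑ n ∈ Finset.range N, coeff n g * t ^ n :=
    eval₂_trunc_eq_sum_range t (RingHom.id ℝ) N g
  rw [heval]
  linarith [(abs_lt.1 (hN t ht)).2, isMinOn_iff.1 hmin t ht]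

end TaylorSeries

section Multiplier

open PowerSeries
open scoped ComplexOrder Polynomial

theorem HereditaryBounded.exists_multiplier_le_hereditaryForm {E : Type*} [NormedAddCommGroup E]
    [NormedSpace ℂ E] [CompleteSpace E] {T : E →L[ℂ] E}
    (hT : spectrum ℂ T ⊆ Metric.closedBall 0 1) {g : ℝ⟦X⟧} (hg : HereditaryBounded g T) {p : ℝ[X]}
    (hp : ∀ t ∈ Set.Icc (0 : ℝ) 1, 0 < p.eval t)
    (hgp : ∀ x, 0 ≤ hereditaryForm (g - p : ℝ⟦X⟧) T x) :
    ∃ h : ℝ⟦X⟧, (∀ n, 0 ≤ coeff n h) ∧ HereditaryBounded h T ∧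
      ∀ x, hereditaryForm (g - p : ℝ⟦X⟧) T x ≤ hereditaryForm (h * g) T x := by
  obtain ⟨h, h₀, h₁, ⟨R, hR, hsum⟩, hhp⟩ := exists_powerSeries_multiplier_nonneg hp
  have hh : HereditaryBounded h T := .of_summable_mul_pow hR hT <| hsum.congr fun n => by
    rw [Real.norm_of_nonneg (h₀ n)]
  have hpb : HereditaryBounded (p : ℝ⟦X⟧) T := .coe_polynomial p
  refine ⟨h, h₀, hh, fun x => ?_⟩
  have hhp_form : 0 ≤ hereditaryForm (h * p : ℝ⟦X⟧) T x :=
    tsum_nonneg fun n => mul_nonneg (by positivity) (hhp n)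
  have hle := hh.coeff_zero_mul_hereditaryForm_le (hg.sub hpb) h₀ hgp x
  rw [h₁, one_mul, mul_sub, (hh.mul hg).hereditaryForm_sub (hh.mul hpb)] at hle
  linarith

variable {H : Type*} [NormedAddCommGroup H] [InnerProductSpace ℂ H] [CompleteSpace H]
  {T A : H →L[ℂ] H} {g : ℝ⟦X⟧}

theorem HasHereditarySumNorm.exists_polynomial_le_hereditaryForm_sub
    (hA : HasHereditarySumNorm (fun n => (‖coeff n g‖ : ℂ)) T A)
    (hs : Summable fun n => ‖coeff n g‖)
    (hpos : ∀ t ∈ Set.Icc (0 : ℝ) 1, 0 < ∑' n, coeff n g * t ^ n) :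
    ∃ p : ℝ[X], (∀ t ∈ Set.Icc (0 : ℝ) 1, 0 < p.eval t) ∧
      ∃ δ > 0, ∀ x, δ * ‖x‖ ^ 2 ≤ hereditaryForm (g - p : ℝ⟦X⟧) T x := by
  obtain ⟨δ, hδ, htrunc⟩ := exists_lt_eval_trunc hs hpos
  obtain ⟨N, hN, htail⟩ := (htrunc.and (hA.eventually_tsum_sub_trunc_le (half_pos hδ))).exists
  refine ⟨g.trunc N - Polynomial.C δ, fun t ht => ?_, δ / 2, half_pos hδ, fun x => ?_⟩
  · rw [Polynomial.eval_sub, Polynomial.eval_C]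
    exact sub_pos.2 (hN t ht)
  have hr : HereditaryBounded (g - (g.trunc N : ℝ⟦X⟧)) T :=
    hA.hasHereditarySumSOT.hereditaryBounded.sub (.coe_polynomial _)
  have hδ_bounded : HereditaryBounded (C (-δ)) T := Polynomial.coe_C (-δ) ▸ .coe_polynomial _
  have hsplit : g - ((g.trunc N - Polynomial.C δ : ℝ[X]) : ℝ⟦X⟧) =
      g - (g.trunc N : ℝ⟦X⟧) - C (-δ) := by
    rw [Polynomial.coe_sub, Polynomial.coe_C, map_neg]
    ring
  rw [hsplit, hr.hereditaryForm_sub hδ_bounded, hereditaryForm_C, smul_eq_mul]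
  linarith [(abs_le.1 ((hr.norm_hereditaryForm_le x).trans (htail x))).1]

theorem HereditaryBounded.exists_equiv_norm_sq_eq (hg : HereditaryBounded g T) {δ : ℝ} (hδ : 0 < δ)
    (hle : ∀ x, δ * ‖x‖ ^ 2 ≤ hereditaryForm g T x) :
    ∃ V : H ≃L[ℂ] H, ∀ x, ‖V x‖ ^ 2 = hereditaryForm g T x := by
  have hgC : HereditaryBounded (g.map (algebraMap ℝ ℂ)) T := hg.map_algebraMap
  obtain ⟨B, hB⟩ := hgC.exists_hasHereditarySumSOT
  exact exists_equiv_norm_sq_eq_of_inner_eq hδ hle fun x =>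
    (hB.inner_eq hgC x).trans (hg.hereditaryForm_map_algebraMap x)

theorem HasHereditarySumNorm.exists_conj_hereditaryForm_nonneg
    (hT : spectrum ℂ T ⊆ Metric.closedBall 0 1)
    (hA : HasHereditarySumNorm (fun n => (‖coeff n g‖ : ℂ)) T A)
    (hs : Summable fun n => ‖coeff n g‖)
    (hpos : ∀ t ∈ Set.Icc (0 : ℝ) 1, 0 < ∑' n, coeff n g * t ^ n)
    {a : ℂ⟦X⟧} (ha : HereditaryBounded a T)
    (hag : ∀ x, 0 ≤ hereditaryForm (a * g.map (algebraMap ℝ ℂ)) T x) :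
    ∃ V : H ≃L[ℂ] H, ∀ y, 0 ≤ hereditaryForm a (V.conjContinuousAlgEquiv T) y := by
  obtain ⟨p, hp, δ, hδ, hgp⟩ := hA.exists_polynomial_le_hereditaryForm_sub hs hpos
  have hg : HereditaryBounded g T := hA.hasHereditarySumSOT.hereditaryBounded
  obtain ⟨h, h₀, hh, hle⟩ := hg.exists_multiplier_le_hereditaryForm hT hp
    fun x => le_trans (by positivity) (hgp x)
  obtain ⟨V, hV⟩ := (hh.mul hg).exists_equiv_norm_sq_eq hδ fun x => (hgp x).trans (hle x)
  refine ⟨V, fun y => ?_⟩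
  obtain ⟨x, rfl⟩ := V.surjective y
  rw [ha.hereditaryForm_conj (hh.mul hg) hV, map_mul, mul_left_comm]
  refine hh.map_algebraMap.hereditaryForm_mul_nonneg (ha.mul hg.map_algebraMap) (fun n => ?_) hag x
  rw [coeff_map]
  exact Complex.zero_le_real.2 (h₀ n)

end Multiplier

theorem theorem1p1_general {H : Type*} [NormedAddCommGroup H] [InnerProductSpace ℂ H]
    [CompleteSpace H]
    (That : H →L[ℂ] H) (hspec : spectrum ℂ That ⊆ Metric.closedBall (0 : ℂ) 1)
    (α γt γ : ℂ → ℂ)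
    (hα : α ∈ algA That)
    (hγt : γt ∈ algAZeroReal That)
    (hpos : ∀ t : ℝ, t ∈ Set.Icc (0 : ℝ) 1 → 0 < (γt (t : ℂ)).re)
    (hγ : ∀ z ∈ Metric.ball (0 : ℂ) 1, γ z = α z * γt z)
    (hnonneg : HereditaryNonneg γ That) :
    ∃ T : H →L[ℂ] H, SimilarOperators That T ∧ HereditaryNonneg α T := by
  obtain ⟨hαW, A, hA⟩ := hα
  obtain ⟨⟨hγtW, B, hB⟩, hreal⟩ := hγt
  obtain ⟨g, hg⟩ := exists_map_algebraMap_eq_taylorSeries hreal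
  simp only [norm_taylorCoeff_eq hg] at hB
  have ha : HereditaryBounded (taylorSeries α) That :=
    HasHereditarySumSOT.hereditaryBounded (by simpa only [coeff_taylorSeries] using hA)
  have hgb : HereditaryBounded g That := hB.hasHereditarySumSOT.hereditaryBounded
  have hmul : taylorSeries γ = taylorSeries α * g.map (algebraMap ℝ ℂ) := by
    rw [hg, ← taylorSeries_mul (analyticAt_of_mem_wienerAlgebra hαW)
      (analyticAt_of_mem_wienerAlgebra hγtW)]
    exact taylorSeries_congr (Filter.mem_of_superset (Metric.ball_mem_nhds 0 one_pos) hγ)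
  have hγb : HereditaryBounded (taylorSeries γ) That := hmul ▸ ha.mul hgb.map_algebraMap
  obtain ⟨V, hV⟩ := hB.exists_conj_hereditaryForm_nonneg hspec
    (hγtW.1.congr (norm_taylorCoeff_eq hg))
    (fun t ht => (hasSum_coeff_mul_pow hγtW hg ht).tsum_eq.symm ▸ hpos t ht) ha
    (hmul ▸ (hereditaryNonneg_iff hγb).1 hnonneg)
  exact ⟨_, ⟨V, rfl⟩, (hereditaryNonneg_iff (ha.conj V)).2 hV⟩

theorem theorem1p1 {H : Type*} [NormedAddCommGroup H] [InnerProductSpace ℂ H] [CompleteSpace H]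
    [TopologicalSpace.SeparableSpace H]
    (That : H →L[ℂ] H) (hspec : spectrum ℂ That ⊆ Metric.closedBall (0 : ℂ) 1)
    (α γt γ : ℂ → ℂ)
    (hα : α ∈ algAReal That)
    (hγt : γt ∈ algAZeroReal That)
    (hpos : ∀ t : ℝ, t ∈ Set.Icc (0 : ℝ) 1 → 0 < (γt (t : ℂ)).re)
    (hγ : ∀ z ∈ Metric.ball (0 : ℂ) 1, γ z = α z * γt z)
    (hnonneg : HereditaryNonneg γ That) :
    ∃ T : H →L[ℂ] H, SimilarOperators That T ∧ HereditaryNonneg α T :=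
  theorem1p1_general That hspec α γt γ hα.1 hγt hpos hγ hnonneg
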